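/- All rings are associative with $1$. A multiplicative set of a ring $R$ is a subset $S$ with $1\in S$, $SS\subseteq S$, $0\notin S$. It is a left Ore set if $Sr\cap Rs\neq\emptyset$ for all $r\in R$, $s\in S$, and a left denominator set if moreover $rs=0$ with $r\in R$, $s\in S$ implies $tr=0$ for some $t\in S$; right Ore and right denominator sets are defined symmetrically. $\mathrm{Ore}(R)$ (resp. $\mathrm{Den}(R)$) is the set of all $S$ that are both left and right Ore (resp. left and right denominator) sets. For a multiplicative set $S$ let $R\langle S^{-1}\rangle$ be the ring freely generated by the ring $R$ and noncommuting indeterminates $x_s$ ($s\in S$), modulo the two-sided ideal generated by all $sx_s-1$ and $x_ss-1$, and let $\mathrm{ass}_R(S)$ be the kernel of $R\to R\langle S^{-1}\rangle$. The set $S$ is left (resp. right) localizable if $R\langle S^{-1}\rangle\ne 0$ and every element of $R\langle S^{-1}\rangle$ has the form $s^{-1}r$ (resp. $rs^{-1}$) with $s\in S$, $r\in R$; it is localizable if it is both. Let $\mathbb L_l(R),\mathbb L_r(R),\mathbb L(R)=\mathbb L_\emptyset(R)$ be the sets of left localizable, right localizable and localizable sets. For $S\in\mathrm{Ore}(R)$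 write $S^{-1}R:=R\langle S^{-1}\rangle$. For a family of sets, $\max$ denotes its set of maximal elements with respect to inclusion. Let $\mathcal C_R$ be the set of regular elements (neither left nor right zero divisors) of $R$, $\min(R)$ the set of minimal prime ideals, and $\mathcal C(\mathfrak p)=\{c\in R\mid c+\mathfrak p\in\mathcal C_{R/\mathfrak p}\}$. **Theorem.** Let $R\ne 0$ be a semiprime (left and right) Goldie ring and, for $*\in\{l,r,\emptyset\}$, let $\mathcal N_*=\{S\in\max\mathbb L_*(R)\mid \mathcal C_R\subseteq S\}$. Then: 1. $\max\mathrm{Ore}(R)=\max\mathrm{Den}(R)=\{\mathcal C(\mathfrak p)\mid\mathfrak p\in\min(R)\}=\mathcal N_*$ for each $*\in\{l,r,\emptyset\}$. 2. For every $S\in\max\mathrm{Ore}(R)$ the ring $S^{-1}R$ is simple Artinian. 3. $\mathcal C_R\in\mathrm{Den}(R)$, and for the classical quotient ring $Q_{cl}(R):=\mathcal C_R^{-1}R\simeq R\mathcal C_R^{-1}$ one has $Q_{cl}(R)\simeq\prod_{S\in\max\mathrm{Ore}(R)}S^{-1}R$; all these isomorphisms can be chosen compatible with the canonical maps from $R$.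 4. $\max\{\mathrm{ass}_R(S)\mid S\in\mathrm{Ore}(R)\}=\{\mathrm{ass}_R(S)\mid S\in\max\mathrm{Ore}(R)\}=\min(R)$. In particular, the ideals $\mathrm{ass}_R(S)$, $S\in\max\mathrm{Ore}(R)$, are pairwise incomparable. -/

import Mathlib

noncomputable section

namespace LocSets

universe u v

/-! ### The ring obtained from `R` by universally inverting a multiplicative set -/

/-- The relations which make the free ring on the disjoint union of `R` and `X` into the ring
freely generated by the ring `R` and the set `X` of noncommuting indeterminates. -/
inductive FreeExtRel (R : Type u) [Ring R] (X : Type v) :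
    FreeAlgebra ℤ (R ⊕ X) → FreeAlgebra ℤ (R ⊕ X) → Prop
  | one : FreeExtRel R X (FreeAlgebra.ι ℤ (Sum.inl 1)) 1
  | add (a b : R) : FreeExtRel R X (FreeAlgebra.ι ℤ (Sum.inl (a + b)))
      (FreeAlgebra.ι ℤ (Sum.inl a) + FreeAlgebra.ι ℤ (Sum.inl b))
  | mul (a b : R) : FreeExtRel R X (FreeAlgebra.ι ℤ (Sum.inl (a * b)))
      (FreeAlgebra.ι ℤ (Sum.inl a) * FreeAlgebra.ι ℤ (Sum.inl b))

/-- `R⟨X⟩`: the ring freely generated by the ring `R` and the set `X` of free noncommutative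
indeterminates (which are not assumed to commute with the elements of `R`). -/
def FreeExt (R : Type u) [Ring R] (X : Type v) : Type (max u v) :=
  RingQuot (FreeExtRel R X)

instance (R : Type u) [Ring R] (X : Type v) : Ring (FreeExt R X) :=
  inferInstanceAs (Ring (RingQuot (FreeExtRel R X)))

/-- The canonical ring homomorphism `R → R⟨X⟩`. -/
def FreeExt.of (R : Type u) [Ring R] (X : Type v) : R →+* FreeExt R X :=
  RingHom.mk'
    { toFun := fun r => RingQuot.mkRingHom (FreeExtRel R X) (FreeAlgebra.ι ℤ (Sum.inl r))
      map_one' := (RingQuot.mkRingHom_rel FreeExtRel.one).trans (map_one _)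
      map_mul' := fun a b => (RingQuot.mkRingHom_rel (FreeExtRel.mul a b)).trans (map_mul _ _ _) }
    (fun a b => (RingQuot.mkRingHom_rel (FreeExtRel.add a b)).trans (map_add _ _ _))

/-- The indeterminates of `R⟨X⟩`. -/
def FreeExt.var (R : Type u) [Ring R] {X : Type v} (x : X) : FreeExt R X :=
  RingQuot.mkRingHom (FreeExtRel R X) (FreeAlgebra.ι ℤ (Sum.inr x))

/-- The relations `s x_s = 1` and `x_s s = 1` for `s ∈ S`. -/
inductive InvertRel {R : Type u} [Ring R] (S : Submonoid R) : FreeExt R S → FreeExt R S → Prop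
  | mul_var (s : S) : InvertRel S (FreeExt.of R S (s : R) * FreeExt.var R s) 1
  | var_mul (s : S) : InvertRel S (FreeExt.var R s * FreeExt.of R S (s : R)) 1

/-- `R⟨S⁻¹⟩`: the quotient of `R⟨x_s : s ∈ S⟩` by the two-sided ideal generated by the elements
`s x_s - 1` and `x_s s - 1`, `s ∈ S`. -/
def Localize {R : Type u} [Ring R] (S : Submonoid R) : Type u :=
  RingQuot (InvertRel S)

instance {R : Type u} [Ring R] (S : Submonoid R) : Ring (Localize S) :=
  inferInstanceAs (Ring (RingQuot (InvertRel S)))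

/-- The canonical ring homomorphism `R → R⟨S⁻¹⟩`. -/
def Localize.of {R : Type u} [Ring R] (S : Submonoid R) : R →+* Localize S :=
  (RingQuot.mkRingHom (InvertRel S)).comp (FreeExt.of R S)

/-- The element `s⁻¹` of `R⟨S⁻¹⟩`, that is, the class of `x_s`. -/
def Localize.inv {R : Type u} [Ring R] {S : Submonoid R} (s : S) : Localize S :=
  RingQuot.mkRingHom (InvertRel S) (FreeExt.var R s)

/-- `ass_R(S)`: the kernel of `R → R⟨S⁻¹⟩`. -/
def ass {R : Type u} [Ring R] (S : Submonoid R) : TwoSidedIdeal R :=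
  TwoSidedIdeal.ker (Localize.of S)

/-! ### Ore sets, denominator sets and localizable sets

A multiplicative set is a submonoid `S` (so `1 ∈ S` and `S S ⊆ S`) with `0 ∉ S`. -/

section Sets

variable (R : Type u) [Ring R]

/-- The left Ore sets: `S r ∩ R s ≠ ∅` for all `r ∈ R`, `s ∈ S`. -/
def leftOre : Set (Submonoid R) :=
  {S | (0 : R) ∉ S ∧ ∀ r : R, ∀ s ∈ S, ∃ s' ∈ S, ∃ r' : R, s' * r = r' * s}

/-- The right Ore sets: `r S ∩ s R ≠ ∅` for all `r ∈ R`, `s ∈ S`. -/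
def rightOre : Set (Submonoid R) :=
  {S | (0 : R) ∉ S ∧ ∀ r : R, ∀ s ∈ S, ∃ s' ∈ S, ∃ r' : R, r * s' = s * r'}

/-- `Ore(R)`: the (left and right) Ore sets of `R`. -/
def ore : Set (Submonoid R) := leftOre R ∩ rightOre R

/-- The left denominator sets. -/
def leftDen : Set (Submonoid R) :=
  {S | S ∈ leftOre R ∧ ∀ r : R, ∀ s ∈ S, r * s = 0 → ∃ t ∈ S, t * r = 0}

/-- The right denominator sets. -/
def rightDen : Set (Submonoid R) :=
  {S | S ∈ rightOre R ∧ ∀ r : R, ∀ s ∈ S, s * r = 0 → ∃ t ∈ S, r * t = 0}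

/-- `Den(R)`: the (left and right) denominator sets of `R`. -/
def den : Set (Submonoid R) := leftDen R ∩ rightDen R

/-- `𝕃_l(R)`: the left localizable sets, for which `R⟨S⁻¹⟩` is nonzero and each of its elements is
a left fraction `s⁻¹ r`. -/
def leftLocalizable : Set (Submonoid R) :=
  {S | (0 : R) ∉ S ∧ Nontrivial (Localize S) ∧
    ∀ q : Localize S, ∃ (s : S) (r : R), q = Localize.inv s * Localize.of S r}

/-- `𝕃_r(R)`: the right localizable sets, for which `R⟨S⁻¹⟩` is nonzero and each of its elements
is a right fraction `r s⁻¹`. -/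
def rightLocalizable : Set (Submonoid R) :=
  {S | (0 : R) ∉ S ∧ Nontrivial (Localize S) ∧
    ∀ q : Localize S, ∃ (s : S) (r : R), q = Localize.of S r * Localize.inv s}

/-- `𝕃(R)`: the localizable sets. -/
def localizable : Set (Submonoid R) := leftLocalizable R ∩ rightLocalizable R

end Sets

/-- The set of maximal elements of a family, with respect to inclusion. -/
def maxElts {α : Type u} [LE α] (F : Set α) : Set α := {S | Maximal (· ∈ F) S}

/-! ### Prime ideals, semiprime Goldie rings -/

/-- A two-sided ideal `P ≠ R` is prime if `a R b ⊆ P` implies `a ∈ P` or `b ∈ P`. -/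
def IsPrimeIdeal {R : Type u} [Ring R] (P : TwoSidedIdeal R) : Prop :=
  P ≠ ⊤ ∧ ∀ a b : R, (∀ r : R, a * r * b ∈ P) → a ∈ P ∨ b ∈ P

/-- `min(R)`: the set of minimal prime ideals of `R`. -/
def minPrimes (R : Type u) [Ring R] : Set (TwoSidedIdeal R) := {P | Minimal IsPrimeIdeal P}

/-- `C(P) = {c ∈ R | c + P is a regular element of R/P}`. -/
def regularMod {R : Type u} [Ring R] (P : TwoSidedIdeal R) : Submonoid R :=
  (nonZeroDivisors P.ringCon.Quotient).comap P.ringCon.mk'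

/-- A ring is semiprime if `a R a = 0` implies `a = 0`. -/
def IsSemiprime (R : Type u) [Ring R] : Prop :=
  ∀ a : R, (∀ r : R, a * r * a = 0) → a = 0

/-- The left annihilator `{r ∈ R | r X = 0}` of a subset `X`, a left ideal. -/
def leftAnn {R : Type u} [Ring R] (X : Set R) : Ideal R where
  carrier := {r | ∀ x ∈ X, r * x = 0}
  add_mem' := fun ha hb x hx => by rw [add_mul, ha x hx, hb x hx, add_zero]
  zero_mem' := fun x _ => zero_mul x
  smul_mem' := fun c r hr x hx => by rw [smul_eq_mul, mul_assoc, hr x hx, mul_zero]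

/-- Left Goldie: finite left uniform dimension (there is no infinite direct sum of nonzero left
ideals inside `R`) and the ascending chain condition on left annihilators. -/
def IsLeftGoldie (R : Type u) [Ring R] : Prop :=
  (∀ I : ℕ → Ideal R, iSupIndep I → ∃ n, I n = ⊥) ∧
  (∀ I : ℕ →o Ideal R, (∀ n, ∃ X : Set R, I n = leftAnn X) → ∃ n, ∀ m, n ≤ m → I m = I n)

/-- Goldie: left Goldie and right Goldie. -/
def IsGoldie (R : Type u) [Ring R] : Prop := IsLeftGoldie R ∧ IsLeftGoldie Rᵐᵒᵖ

/-- A simple ring which is left and right Artinian. -/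
def IsSimpleArtinian (A : Type u) [Ring A] : Prop :=
  IsSimpleRing A ∧ IsArtinianRing A ∧ IsArtinianRing Aᵐᵒᵖ

/-! ### Ore's rings of left and right fractions, classical quotient rings -/

section Fractions

variable {R : Type u} [Ring R] {S : Submonoid R}

lemma nonempty_oreSet (h : S ∈ leftDen R) : Nonempty (OreLocalization.OreSet S) := by
  rw [OreLocalization.nonempty_oreSet_iff]
  refine ⟨fun r₁ r₂ s hs => ?_, fun r s => ?_⟩
  · obtain ⟨t, ht, h0⟩ := h.2 (r₁ - r₂) s s.2 (by rw [sub_mul, hs, sub_self])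
    exact ⟨⟨t, ht⟩, by rwa [mul_sub, sub_eq_zero] at h0⟩
  · obtain ⟨s', hs', r', e⟩ := h.1.2 r s s.2
    exact ⟨r', ⟨s', hs'⟩, e⟩

lemma op_mem_leftDen (h : S ∈ rightDen R) : S.op ∈ leftDen Rᵐᵒᵖ := by
  refine ⟨⟨fun h0 => h.1.1 (by simpa using h0), fun r s hs => ?_⟩, fun r s hs e => ?_⟩
  · obtain ⟨s', hs', r', e⟩ := h.1.2 r.unop s.unop hs
    exact ⟨.op s', hs', .op r', MulOpposite.unop_injective e⟩
  · obtain ⟨t, ht, e'⟩ := h.2 r.unop s.unop hs (congrArg MulOpposite.unop e)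
    exact ⟨.op t, ht, MulOpposite.unop_injective e'⟩

/-- Ore's ring of left fractions `S⁻¹R` at a left denominator set `S`. -/
def LeftFrac (S : Submonoid R) (h : S ∈ leftDen R) : Type u :=
  @OreLocalization R _ S (nonempty_oreSet h).some R _

instance (h : S ∈ leftDen R) : Ring (LeftFrac S h) :=
  letI := (nonempty_oreSet h).some
  inferInstanceAs (Ring (OreLocalization S R))

/-- The canonical homomorphism `R → S⁻¹R`. -/
def LeftFrac.of (h : S ∈ leftDen R) : R →+* LeftFrac S h :=
  letI := (nonempty_oreSet h).some
  (OreLocalization.numeratorRingHom : R →+* OreLocalization S R)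

/-- Ore's ring of right fractions `RS⁻¹` at a right denominator set `S`: the opposite of the ring
of left fractions of the opposite ring. -/
abbrev RightFrac (S : Submonoid R) (h : S ∈ rightDen R) : Type u :=
  (LeftFrac S.op (op_mem_leftDen h))ᵐᵒᵖ

/-- The canonical homomorphism `R → RS⁻¹`. -/
def RightFrac.of (h : S ∈ rightDen R) : R →+* RightFrac S h :=
  (LeftFrac.of (op_mem_leftDen h)).op.comp (RingEquiv.opOp R).toRingHom

end Fractions

end LocSets

end

/-! By Goldie's theorem the classical quotient ring of `R` is semisimple, hence a finite product of
simple Artinian rings `A i`; everything is read off from the embedding `f : R → ∏ A i`. Let U_i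
(`unitsAt`) be the elements that become units in `A i`, and P_i (`kerAt`) the kernel of R → `A i`.

Clearing denominators in the idempotent of the factor `A i` gives some t in R that is a unit at i
and zero at every other component. Since t annihilates P_i on both sides, U_i is a denominator set
with localization `A i`; the same t shows that the U_i, and likewise the P_i, are pairwise
incomparable. The P_i are prime with zero intersection, so they are the minimal primes, and C(P_i) =
U_i because regular elements of Artinian rings are units.

It remains to put each competing set S inside some U_i. For Ore sets this is
`exists_le_unitsAt_of_mem_ore`, resting on the chain condition and the primeness of P_i. For S
containing all regular elements, `exists_le_unitsAt_of_nontrivial` uses only that R⟨S⁻¹⟩ is nonzero,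
which settles the left, right and two-sided cases at once. -/

noncomputable section

namespace LocSets

universe u v w

/-! ### Goldie's theorem -/

section Goldie

variable {R : Type u} [Ring R]

/-- The left annihilator of an element. -/
abbrev lann (a : R) : Ideal R := leftAnn {a}

lemma mem_lann {a x : R} : x ∈ lann a ↔ x * a = 0 :=
  ⟨fun h => h a rfl, fun h y hy => by rw [Set.mem_singleton_iff.1 hy, h]⟩

/-! ### Essential left ideals. -/

/-- A left ideal is essential if it meets every nonzero left ideal. -/
def IsEssential (I : Ideal R) : Prop := ∀ x : R, x ≠ 0 → ∃ y : R, y * x ≠ 0 ∧ y * x ∈ I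

lemma IsEssential.mono {I J : Ideal R} (h : IsEssential I) (hIJ : I ≤ J) : IsEssential J :=
  fun x hx => let ⟨y, hy, hyI⟩ := h x hx; ⟨y, hy, hIJ hyI⟩

lemma IsEssential.comap_mul_right {I : Ideal R} (h : IsEssential I) (r : R) :
    IsEssential (Submodule.comap (LinearMap.toSpanSingleton R R r) I) := by
  intro x hx
  by_cases hxr : x * r = 0
  · exact ⟨1, by rwa [one_mul], by simp [hxr]⟩
  · obtain ⟨y, hy, hyI⟩ := h _ hxr
    refine ⟨y, fun h0 => hy (by rw [← mul_assoc, h0, zero_mul]), ?_⟩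
    simpa [mul_assoc] using hyI

/-- Every left ideal has a complement up to an essential left ideal. -/
lemma exists_disjoint_isEssential_sup (J : Ideal R) :
    ∃ K : Ideal R, Disjoint J K ∧ IsEssential (J ⊔ K) := by
  obtain ⟨K, hK⟩ := zorn_le₀ {K : Ideal R | Disjoint J K} (fun c hc hchain =>
    ⟨sSup c, hchain.directedOn.disjoint_sSup_right.2 fun K hK => hc hK, fun _ hz => le_sSup hz⟩)
  refine ⟨K, hK.1, fun x hx => ?_⟩
  by_cases hxK : x ∈ K
  · exact ⟨1, by rwa [one_mul], by rw [one_mul]; exact Ideal.mem_sup_right hxK⟩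
  -- By maximality of K, some nonzero j = y x + k lies in J, so y x = j - k lies in J + K; if y x =
  -- 0, then j = k would lie in J ∩ K.
  have hnd : ¬ Disjoint J (Ideal.span {x} ⊔ K) := fun hd =>
    hxK (hK.2 hd le_sup_right (Ideal.mem_sup_left (Ideal.mem_span_singleton_self x)))
  rw [Submodule.disjoint_def] at hnd
  push Not at hnd
  obtain ⟨j, hj, hjs, hj0⟩ := hnd
  obtain ⟨a, ha, k, hk, rfl⟩ := Submodule.mem_sup.1 hjs
  obtain ⟨y, rfl⟩ := Ideal.mem_span_singleton'.1 ha
  refine ⟨y, fun h0 => hj0 ?_, ?_⟩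
  · rw [h0, zero_add] at hj ⊢
    exact Submodule.disjoint_def.1 hK.1 k hj hk
  · have := Submodule.sub_mem _ (Ideal.mem_sup_left (T := K) hj) (Ideal.mem_sup_right (S := J) hk)
    rwa [add_sub_cancel_right] at this

/-! ### Chain conditions on annihilators of elements. -/

lemma exists_lann_maximal (hG : IsLeftGoldie R) (P : R → Prop) (hP : ∃ a, P a) :
    ∃ a, P a ∧ ∀ b, P b → lann a ≤ lann b → lann b ≤ lann a := by
  have wf : WellFoundedGT {I : Ideal R // ∃ X : Set R, I = leftAnn X} := by
    rw [wellFoundedGT_iff_monotone_chain_condition]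
    intro I
    obtain ⟨n, hn⟩ := hG.2 ⟨fun n => (I n).1, fun _ _ h => I.monotone h⟩ fun n => (I n).2
    exact ⟨n, fun m hm => Subtype.ext (hn m hm).symm⟩
  obtain ⟨a₀, ha₀⟩ := hP
  obtain ⟨I, ⟨a, ha, rfl⟩, hmax⟩ := wf.wf.has_min
    {I : {I : Ideal R // ∃ X : Set R, I = leftAnn X} | ∃ a, P a ∧ I = ⟨lann a, _, rfl⟩}
    ⟨_, a₀, ha₀, rfl⟩
  refine ⟨a, ha, fun b hb hab => ?_⟩
  by_contra hba
  exact hmax _ ⟨b, hb, rfl⟩ (lt_of_le_not_ge hab hba)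

-- The map sending a left annihilator to its right annihilator reverses inclusions and is injective,
-- since the left annihilator of `a` is recovered by annihilating twice more. Thus ACC on right
-- annihilators acts as DCC here.
open MulOpposite in
lemma exists_lann_minimal (hG : IsLeftGoldie Rᵐᵒᵖ) (P : R → Prop) (hP : ∃ a, P a) :
    ∃ a, P a ∧ ∀ b, P b → lann b ≤ lann a → lann a ≤ lann b := by
  have wf : WellFoundedGT {I : Ideal Rᵐᵒᵖ // ∃ X : Set Rᵐᵒᵖ, I = leftAnn X} := by
    rw [wellFoundedGT_iff_monotone_chain_condition]
    intro I
    obtain ⟨n, hn⟩ := hG.2 ⟨fun n => (I n).1, fun _ _ h => I.monotone h⟩ fun n => (I n).2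
    exact ⟨n, fun m hm => Subtype.ext (hn m hm).symm⟩
  obtain ⟨a₀, ha₀⟩ := hP
  obtain ⟨I, ⟨a, ha, rfl⟩, hmax⟩ := wf.wf.has_min
    {I : {I : Ideal Rᵐᵒᵖ // ∃ X : Set Rᵐᵒᵖ, I = leftAnn X} |
      ∃ a, P a ∧ I = ⟨leftAnn (op '' (lann a : Set R)), _, rfl⟩}
    ⟨_, a₀, ha₀, rfl⟩
  refine ⟨a, ha, fun b hb hab => ?_⟩
  have hle : leftAnn (op '' (lann a : Set R)) ≤ leftAnn (op '' (lann b : Set R)) :=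
    fun r hr x hx => hr x (Set.image_mono hab hx)
  by_contra hba
  refine hmax _ ⟨b, hb, rfl⟩ (lt_of_le_not_ge hle fun hge => hba ?_)
  have hbb : op b ∈ leftAnn (op '' (lann b : Set R)) := by
    rintro _ ⟨x, hx, rfl⟩
    rw [← op_mul, mem_lann.1 hx, op_zero]
  intro x hx
  refine mem_lann.2 (op_injective ?_)
  have := hge hbb (op x) ⟨x, hx, rfl⟩
  rwa [← op_mul] at this

/-- In a semiprime ring with ACC on left annihilators, nil left ideals vanish. -/
lemma eq_bot_of_nil (hsp : IsSemiprime R) (hG : IsLeftGoldie R) (L : Ideal R)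
    (hL : ∀ x ∈ L, IsNilpotent x) : L = ⊥ := by
  by_contra hne
  obtain ⟨b, ⟨hb, hb0⟩, hmax⟩ := exists_lann_maximal hG (fun b => b ∈ L ∧ b ≠ 0)
    (Submodule.exists_mem_ne_zero_of_ne_bot hne)
  refine hb0 (hsp b fun r => ?_)
  by_contra hbrb
  -- By maximality, b r b has the same left annihilator as b. Hence no (b r)^k b vanishes, although
  -- r b is nilpotent.
  have hle : lann (b * r * b) ≤ lann b := by
    refine hmax _ ⟨L.mul_mem_left _ hb, hbrb⟩ fun x hx => mem_lann.2 ?_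
    rw [← mul_assoc, ← mul_assoc, mem_lann.1 hx, zero_mul, zero_mul]
  have step : ∀ k, (b * r) ^ k * b ≠ 0 := by
    intro k
    induction k with
    | zero => simpa using hb0
    | succ k ih =>
      intro h
      refine ih (mem_lann.1 (hle (mem_lann.2 ?_)))
      rwa [pow_succ, mul_assoc] at h
  obtain ⟨n, hn⟩ := hL _ (L.mul_mem_left r hb)
  refine step n ?_
  have : ∀ k, (b * r) ^ k * b = b * (r * b) ^ k := by
    intro k
    induction k with
    | zero => simp
    | succ k ih => rw [pow_succ', mul_assoc, ih, pow_succ' (r * b)]; simp only [mul_assoc]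
  rw [this, hn, mul_zero]

/-- A semiprime ring with ACC on left annihilators is left nonsingular. -/
lemma eq_zero_of_isEssential_lann (hsp : IsSemiprime R) (hG : IsLeftGoldie R) {z : R}
    (hz : IsEssential (lann z)) : z = 0 := by
  -- For w^n with maximal left annihilator, a nonzero y w^n killed by w on the right would make the
  -- annihilator of w^(n+1) strictly larger.
  have nil : ∀ w : R, IsEssential (lann w) → IsNilpotent w := by
    intro w hw
    obtain ⟨_, ⟨n, rfl⟩, hmax⟩ := exists_lann_maximal hG (fun a => ∃ n : ℕ, a = w ^ n) ⟨_, 0, rfl⟩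
    refine ⟨n, ?_⟩
    by_contra h0
    obtain ⟨y, hy, hyw⟩ := hw _ h0
    refine hy (mem_lann.1 (hmax (w ^ (n + 1)) ⟨_, rfl⟩ (fun x hx => mem_lann.2 ?_) (mem_lann.2 ?_)))
    · rw [pow_succ, ← mul_assoc, mem_lann.1 hx, zero_mul]
    · rw [pow_succ, ← mul_assoc]; exact mem_lann.1 hyw
  have hbot := eq_bot_of_nil hsp hG (Ideal.span {z}) (by
    intro x hx
    obtain ⟨r, rfl⟩ := Ideal.mem_span_singleton'.1 hx
    obtain ⟨n, hn⟩ := nil (z * r) (hz.mono fun x hx => mem_lann.2 (by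
      rw [← mul_assoc, mem_lann.1 hx, zero_mul]))
    refine ⟨n + 1, ?_⟩
    have : ∀ k, (r * z) ^ (k + 1) = r * (z * r) ^ k * z := by
      intro k
      induction k with
      | zero => simp
      | succ k ih => rw [pow_succ, ih, pow_succ (z * r)]; simp only [mul_assoc]
    rw [this, hn, mul_zero, zero_mul])
  exact Ideal.span_singleton_eq_bot.1 hbot

/-- Every element has a power whose left annihilator agrees with that of its square. -/
lemma exists_pow_lann_sq (hG : IsLeftGoldie R) (b : R) :
    ∃ n : ℕ, n ≠ 0 ∧ ∀ x, x * b ^ n * b ^ n = 0 → x * b ^ n = 0 := by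
  obtain ⟨_, ⟨n, hn, rfl⟩, hmax⟩ :=
    exists_lann_maximal hG (fun a => ∃ n : ℕ, n ≠ 0 ∧ a = b ^ n) ⟨_, 1, one_ne_zero, rfl⟩
  refine ⟨n, hn, fun x hx => mem_lann.1 (hmax (b ^ n * b ^ n)
    ⟨n + n, by omega, (pow_add b n n).symm⟩ (fun y hy => mem_lann.2 ?_) (mem_lann.2 ?_))⟩
  · rw [← mul_assoc, mem_lann.1 hy, zero_mul]
  · rwa [← mul_assoc]

/-- Choose a in E with Ra ∩ lann(a) = 0 and lann(a) minimal. If lann(a) ≠ 0, it meets E in a left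
ideal that is not nil, which contains a nonzero c of the same kind with c a = 0. Then lann(a + c) =
lann(a) ∩ lann(c), and minimality forces c c = 0, hence c = 0. -/
lemma exists_mem_lann_eq_bot (hsp : IsSemiprime R) (hG : IsGoldie R) {E : Ideal R}
    (hE : IsEssential E) : ∃ a ∈ E, ∀ x, x * a = 0 → x = 0 := by
  obtain ⟨a, ⟨haE, ha⟩, hmin⟩ := exists_lann_minimal hG.2
    (fun a => a ∈ E ∧ ∀ x, x * a * a = 0 → x * a = 0) ⟨0, E.zero_mem, fun x _ => mul_zero x⟩
  refine ⟨a, haE, fun y hy => ?_⟩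
  by_contra hy0
  obtain ⟨z, hz0, hzE⟩ := hE y hy0
  have hN : E ⊓ lann a ≠ ⊥ := fun h => hz0 <| (Submodule.mem_bot R).1 <| h ▸
    Submodule.mem_inf.2 ⟨hzE, mem_lann.2 (by rw [mul_assoc, hy, mul_zero])⟩
  obtain ⟨b, hbN, hbn⟩ : ∃ b ∈ E ⊓ lann a, ¬ IsNilpotent b := by
    by_contra! h
    exact hN (eq_bot_of_nil hsp hG.1 _ h)
  obtain ⟨n, hn, hsq⟩ := exists_pow_lann_sq hG.1 b
  have hcN : b ^ n ∈ E ⊓ lann a := by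
    obtain ⟨k, rfl⟩ := Nat.exists_eq_succ_of_ne_zero hn
    rw [pow_succ]; exact Submodule.smul_mem _ _ hbN
  have hc0 : b ^ n ≠ 0 := fun h => hbn ⟨n, h⟩
  set c := b ^ n
  have hca : c * a = 0 := mem_lann.1 hcN.2
  have split : ∀ x, x * (a + c) = 0 → x * a = 0 ∧ x * c = 0 := by
    intro x hx
    rw [mul_add] at hx
    have h1 : x * a = 0 := ha x (by
      have := congrArg (· * a) hx
      simpa only [add_mul, mul_assoc x c a, hca, mul_zero, add_zero, zero_mul] using this)
    exact ⟨h1, by rwa [h1, zero_add] at hx⟩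
  have hle := hmin (a + c) ⟨E.add_mem haE hcN.1, fun x hx => by
    obtain ⟨h1, h2⟩ := split _ hx
    rw [mul_add, add_mul] at h1 h2
    rw [mul_assoc x c a, hca, mul_zero, add_zero] at h1
    have h3 := ha x h1
    rw [h3, zero_mul, zero_add] at h2
    rw [mul_add, h3, hsq x h2, add_zero]⟩ (fun x hx => mem_lann.2 (split x (mem_lann.1 hx)).1)
  have hcc := (split c (mem_lann.1 (hle (mem_lann.2 hca)))).2
  exact hc0 (by simpa using hsq 1 (by rwa [one_mul]))

/-- With finite left uniform dimension, a left ideal generated by a right regular element is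
essential. -/
lemma isEssential_span_of_lann (hG : IsLeftGoldie R) {c : R} (hc : ∀ x, x * c = 0 → x = 0) :
    IsEssential (Ideal.span {c}) := by
  intro x hx
  by_contra! hdis
  -- If Rx ∩ Rc = 0, the left ideals R x c^i are independent: the term i = 0 of a relation lies in
  -- Rx ∩ Rc, so it vanishes, and one factor c cancels from the rest.
  have key : ∀ n : ℕ, ∀ r : ℕ → R, ∑ i ∈ Finset.range n, r i * x * c ^ i = 0 →
      ∀ i < n, r i * x = 0 := by
    intro n
    induction n with
    | zero => intro r _ i hi; omega
    | succ n ih =>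
      intro r hr
      have hr' : (∑ i ∈ Finset.range n, r (i + 1) * x * c ^ i) * c + r 0 * x = 0 := by
        rw [Finset.sum_range_succ'] at hr
        rw [Finset.sum_mul]
        simpa [pow_succ, mul_assoc] using hr
      have h0 : r 0 * x = 0 := by
        by_contra h0
        refine hdis _ h0 (Ideal.mem_span_singleton'.2
          ⟨-(∑ i ∈ Finset.range n, r (i + 1) * x * c ^ i), ?_⟩)
        rw [neg_mul]; exact neg_eq_of_add_eq_zero_right hr'
      rw [h0, add_zero] at hr'
      intro i hi
      cases i with
      | zero => exact h0
      | succ i => exact ih (fun i => r (i + 1)) (hc _ hr') i (by omega)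
  obtain ⟨n, hn⟩ := hG.1 (fun n => Ideal.span {x * c ^ n}) (by
    classical
    rw [iSupIndep_iff_finsetSum_eq_zero_imp_eq_zero]
    intro s v hv hsum i hi
    have hv' : ∀ i, ∃ r : R, r * x * c ^ i = if i ∈ s then v i else 0 := by
      intro i
      split_ifs with his
      · obtain ⟨r, hr⟩ := Ideal.mem_span_singleton'.1 (hv i his)
        exact ⟨r, by rw [mul_assoc, hr]⟩
      · exact ⟨0, by simp⟩
    choose r hr using hv'
    obtain ⟨n, hn⟩ := s.exists_nat_subset_range
    have := key n r (by
      simp only [hr]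
      rw [Finset.sum_ite_mem, Finset.inter_eq_right.2 hn, hsum]) i (Finset.mem_range.1 (hn hi))
    have h2 := hr i
    rwa [this, zero_mul, if_pos hi, eq_comm] at h2)
  rw [Ideal.span_singleton_eq_bot] at hn
  refine hx ?_
  clear hdis key
  induction n with
  | zero => simpa using hn
  | succ n ih => exact ih (hc _ (by rwa [pow_succ, ← mul_assoc] at hn))

/-- In a semiprime Goldie ring, essential left ideals contain regular elements. -/
theorem IsEssential.exists_mem_nonZeroDivisors (hsp : IsSemiprime R) (hG : IsGoldie R)
    {E : Ideal R} (hE : IsEssential E) : ∃ c ∈ E, c ∈ nonZeroDivisors R := by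
  obtain ⟨c, hcE, hc⟩ := exists_mem_lann_eq_bot hsp hG hE
  refine ⟨c, hcE, mem_nonZeroDivisors_iff.2 ⟨fun x hx => ?_, hc⟩⟩
  -- If c x = 0, the left annihilator of x contains the essential left ideal Rc, so nonsingularity
  -- gives x = 0.
  refine eq_zero_of_isEssential_lann hsp hG.1 ((isEssential_span_of_lann hG.1 hc).mono ?_)
  rw [Ideal.span_singleton_le_iff_mem]
  exact mem_lann.2 hx

/-- For s regular, Rs is essential, hence so is {y | y r ∈ Rs}; a regular element of the latter
gives the Ore condition. -/
theorem nonZeroDivisors_mem_leftDen [Nontrivial R] (hsp : IsSemiprime R) (hG : IsGoldie R) :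
    nonZeroDivisors R ∈ leftDen R := by
  refine ⟨⟨zero_notMem_nonZeroDivisors, fun r s hs => ?_⟩, fun r s hs h => ⟨1, one_mem _, ?_⟩⟩
  · obtain ⟨c, hc, hcr⟩ := ((isEssential_span_of_lann hG.1
      (mem_nonZeroDivisors_iff.1 hs).2).comap_mul_right r).exists_mem_nonZeroDivisors hsp hG
    obtain ⟨r', hr'⟩ := Ideal.mem_span_singleton'.1 (Submodule.mem_comap.1 hc)
    exact ⟨c, hcr, r', by simpa using hr'.symm⟩
  · rw [(mem_nonZeroDivisors_iff.1 hs).2 r h, mul_zero]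

/-- Goldie's theorem: a ring of left fractions of a semiprime Goldie ring at its regular elements
is semisimple. -/
theorem isSemisimpleRing_of_left_fractions (hsp : IsSemiprime R) (hG : IsGoldie R)
    {Q : Type v} [Ring Q] (ι : R →+* Q) (hinj : Function.Injective ι)
    (hunit : ∀ c ∈ nonZeroDivisors R, IsUnit (ι c))
    (hfrac : ∀ q : Q, ∃ c ∈ nonZeroDivisors R, ∃ r : R, ι c * q = ι r) : IsSemisimpleRing Q := by
  refine { exists_isCompl := fun J => ?_ }
  obtain ⟨K, hd, hE⟩ := exists_disjoint_isEssential_sup J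
  refine ⟨K, hd, codisjoint_iff.2 ?_⟩
  -- The essential left ideal J + K of Q contracts to an essential left ideal of R, which contains a
  -- regular element, that is, a unit of Q.
  have hE' : IsEssential ((J ⊔ K : Ideal Q).comap ι) := by
    intro x hx
    obtain ⟨q, hq0, hq⟩ := hE (ι x) fun h => hx (hinj (h.trans (map_zero ι).symm))
    obtain ⟨c, hc, r, hr⟩ := hfrac q
    have e : ι (r * x) = ι c * (q * ι x) := by rw [map_mul, ← hr, mul_assoc]
    refine ⟨r, fun h0 => hq0 ?_, ?_⟩
    · rw [h0, map_zero] at e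
      exact (hunit c hc).mul_right_eq_zero.1 e.symm
    · rw [Ideal.mem_comap, e]
      exact Ideal.mul_mem_left _ _ hq
  obtain ⟨c, hc, hcr⟩ := hE'.exists_mem_nonZeroDivisors hsp hG
  exact Ideal.eq_top_of_isUnit_mem _ hc (hunit c hcr)

lemma IsSemiprime.op (hsp : IsSemiprime R) : IsSemiprime Rᵐᵒᵖ := by
  intro a h
  refine MulOpposite.unop_injective (hsp _ fun r => ?_)
  have := congrArg MulOpposite.unop (h (.op r))
  simpa [mul_assoc] using this

end Goldie

/-! ### Universal properties of the rings of fractions -/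

section Universal

variable {R : Type u} [Ring R] {S : Submonoid R} {A : Type v} [Ring A]

/-- The homomorphism `R⟨X⟩ → A` determined by a homomorphism `R → A` and a map `X → A`. -/
def FreeExt.lift {X : Type w} (f : R →+* A) (g : X → A) : FreeExt R X →+* A :=
  RingQuot.lift ⟨(FreeAlgebra.lift ℤ (Sum.elim f g) : FreeAlgebra ℤ (R ⊕ X) →ₐ[ℤ] A), by
    intro x y h
    cases h <;> simp⟩

lemma FreeExt.lift_of {X : Type w} (f : R →+* A) (g : X → A) (r : R) :
    FreeExt.lift f g (FreeExt.of R X r) = f r := by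
  change RingQuot.lift _ (RingQuot.mkRingHom _ _) = _
  rw [RingQuot.lift_mkRingHom_apply]
  simp

lemma FreeExt.lift_var {X : Type w} (f : R →+* A) (g : X → A) (x : X) :
    FreeExt.lift f g (FreeExt.var R x) = g x := by
  change RingQuot.lift _ (RingQuot.mkRingHom _ _) = _
  rw [RingQuot.lift_mkRingHom_apply]
  simp

lemma FreeExt.hom_ext {X : Type w} {g h : FreeExt R X →+* A}
    (hof : ∀ r, g (FreeExt.of R X r) = h (FreeExt.of R X r))
    (hvar : ∀ x, g (FreeExt.var R x) = h (FreeExt.var R x)) : g = h := by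
  refine RingQuot.ringQuot_ext _ _ ?_
  have : (g.comp (RingQuot.mkRingHom _)).toIntAlgHom =
      (h.comp (RingQuot.mkRingHom (FreeExtRel R X))).toIntAlgHom := by
    refine FreeAlgebra.hom_ext (funext ?_)
    rintro (r | x)
    · exact hof r
    · exact hvar x
  exact RingHom.ext fun x => DFunLike.congr_fun this x

lemma Localize.of_mul_inv (s : S) : Localize.of S (s : R) * Localize.inv s = 1 := by
  have := RingQuot.mkRingHom_rel (InvertRel.mul_var s)
  rwa [map_mul, map_one] at this

lemma Localize.inv_mul_of (s : S) : Localize.inv s * Localize.of S (s : R) = 1 := by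
  have := RingQuot.mkRingHom_rel (InvertRel.var_mul s)
  rwa [map_mul, map_one] at this

lemma Localize.isUnit_of {s : R} (hs : s ∈ S) : IsUnit (Localize.of S s) :=
  ⟨⟨_, _, Localize.of_mul_inv ⟨s, hs⟩, Localize.inv_mul_of ⟨s, hs⟩⟩, rfl⟩

/-- `R⟨S⁻¹⟩` is universal among the rings in which the elements of `S` become units. -/
lemma Localize.exists_lift {f : R →+* A} (hf : ∀ s ∈ S, IsUnit (f s)) :
    ∃ g : Localize S →+* A, ∀ r, g (Localize.of S r) = f r := by
  let k : FreeExt R S →+* A := FreeExt.lift f fun s => ((hf s s.2).unit⁻¹ : Aˣ)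
  have hk : ∀ ⦃x y⦄, InvertRel S x y → k x = k y := by
    intro x y h
    cases h with
    | mul_var s => simp only [k, map_mul, FreeExt.lift_of, FreeExt.lift_var, map_one,
        IsUnit.mul_val_inv]
    | var_mul s => simp only [k, map_mul, FreeExt.lift_of, FreeExt.lift_var, map_one,
        IsUnit.val_inv_mul]
  refine ⟨RingQuot.lift ⟨k, hk⟩, fun r => ?_⟩
  change RingQuot.lift _ (RingQuot.mkRingHom _ _) = _
  rw [RingQuot.lift_mkRingHom_apply]
  exact FreeExt.lift_of _ _ _

lemma Localize.hom_ext {g h : Localize S →+* A}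
    (hof : ∀ r, g (Localize.of S r) = h (Localize.of S r)) : g = h := by
  refine RingQuot.ringQuot_ext _ _ ?_
  refine FreeExt.hom_ext (g := RingHom.comp g (RingQuot.mkRingHom (InvertRel S)))
    (h := RingHom.comp h (RingQuot.mkRingHom (InvertRel S))) hof fun s => ?_
  change g (Localize.inv s) = h (Localize.inv s)
  have e : IsUnit (g (Localize.of S s)) := (Localize.isUnit_of s.2).map g
  refine e.mul_left_cancel ?_
  rw [← map_mul, Localize.of_mul_inv, hof, ← map_mul, Localize.of_mul_inv, map_one, map_one]

lemma LeftFrac.isUnit_of (h : S ∈ leftDen R) {s : R} (hs : s ∈ S) : IsUnit (LeftFrac.of h s) :=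
  let := (nonempty_oreSet h).some
  OreLocalization.numerator_isUnit (⟨s, hs⟩ : S)

lemma LeftFrac.exists_frac (h : S ∈ leftDen R) (q : LeftFrac S h) :
    ∃ s ∈ S, ∃ r, LeftFrac.of h s * q = LeftFrac.of h r := by
  let := (nonempty_oreSet h).some
  change OreLocalization S R at q
  induction q with | _ r s
  refine ⟨s, s.2, r, ?_⟩
  change ((s : R) /ₒ (1 : S) : OreLocalization S R) * (r /ₒ s) = r /ₒ (1 : S)
  exact OreLocalization.mul_cancel

lemma LeftFrac.exists_lift (h : S ∈ leftDen R) {f : R →+* A} (hf : ∀ s ∈ S, IsUnit (f s)) :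
    ∃ g : LeftFrac S h →+* A, ∀ r, g (LeftFrac.of h r) = f r := by
  let := (nonempty_oreSet h).some
  refine ⟨OreLocalization.universalHom f (IsUnit.liftRight ((f : R →* A).comp S.subtype)
    fun s => hf s s.2) fun s => rfl, fun r => ?_⟩
  exact OreLocalization.universalHom_commutes _ _ _

lemma LeftFrac.of_injective (h : S ∈ leftDen R) (hS : S ≤ nonZeroDivisors R) :
    Function.Injective (LeftFrac.of h) := by
  let := (nonempty_oreSet h).some
  exact OreLocalization.numeratorHom_inj fun s hs => (mem_nonZeroDivisors_iff.1 (hS hs)).1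

/-- Homomorphisms out of a ring of left fractions are determined by the numerators. -/
lemma hom_ext_of_left_fractions {Q : Type*} [Ring Q] {ι : R →+* Q}
    (hunit : ∀ s ∈ S, IsUnit (ι s)) (hfrac : ∀ q, ∃ s ∈ S, ∃ r, ι s * q = ι r) {g h : Q →+* A}
    (hgh : ∀ r, g (ι r) = h (ι r)) : g = h := by
  ext q
  obtain ⟨s, hs, r, e⟩ := hfrac q
  refine ((hunit s hs).map g).mul_left_cancel ?_
  rw [← map_mul, e, hgh, hgh, ← map_mul, e]

lemma LeftFrac.hom_ext (h : S ∈ leftDen R) {g k : LeftFrac S h →+* A}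
    (hgk : ∀ r, g (LeftFrac.of h r) = k (LeftFrac.of h r)) : g = k :=
  hom_ext_of_left_fractions (fun _ => LeftFrac.isUnit_of h) (LeftFrac.exists_frac h) hgk

lemma RightFrac.isUnit_of (h : S ∈ rightDen R) {s : R} (hs : s ∈ S) : IsUnit (RightFrac.of h s) :=
  (LeftFrac.isUnit_of (op_mem_leftDen h) (s := .op s) hs).op

lemma RightFrac.exists_lift (h : S ∈ rightDen R) {f : R →+* A} (hf : ∀ s ∈ S, IsUnit (f s)) :
    ∃ g : RightFrac S h →+* A, ∀ r, g (RightFrac.of h r) = f r := by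
  obtain ⟨g, hg⟩ := LeftFrac.exists_lift (op_mem_leftDen h) (f := f.op)
    fun s hs => (hf s.unop hs).op
  refine ⟨(RingEquiv.opOp A).symm.toRingHom.comp g.op, fun r => ?_⟩
  exact congrArg MulOpposite.unop (hg (.op r))

lemma RightFrac.exists_frac (h : S ∈ rightDen R) (q : RightFrac S h) :
    ∃ s ∈ S, ∃ r, q * RightFrac.of h s = RightFrac.of h r := by
  obtain ⟨s, hs, r, e⟩ := LeftFrac.exists_frac (op_mem_leftDen h) q.unop
  exact ⟨s.unop, hs, r.unop, MulOpposite.unop_injective e⟩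

lemma RightFrac.hom_ext (h : S ∈ rightDen R) {g k : RightFrac S h →+* A}
    (hgk : ∀ r, g (RightFrac.of h r) = k (RightFrac.of h r)) : g = k := by
  ext q
  obtain ⟨s, hs, r, e⟩ := RightFrac.exists_frac h q
  refine ((RightFrac.isUnit_of h hs).map g).mul_right_cancel ?_
  rw [← map_mul, e, hgk, hgk, ← map_mul, e]

/-- The rings of left and of right fractions agree. -/
lemma exists_leftFrac_equiv_rightFrac (hl : S ∈ leftDen R) (hr : S ∈ rightDen R) :
    ∃ e : LeftFrac S hl ≃+* RightFrac S hr, ∀ r, e (LeftFrac.of hl r) = RightFrac.of hr r := by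
  obtain ⟨g, hg⟩ := LeftFrac.exists_lift hl fun s hs => RightFrac.isUnit_of hr hs
  obtain ⟨k, hk⟩ := RightFrac.exists_lift hr fun s hs => LeftFrac.isUnit_of hl hs
  refine ⟨RingEquiv.ofRingHom g k (RightFrac.hom_ext hr fun r => ?_)
    (LeftFrac.hom_ext hl fun r => ?_), hg⟩
  · simp [hg, hk]
  · simp [hg, hk]

end Universal

/-! ### Ore sets and denominator sets of Goldie rings -/

section Ore

variable {R : Type u} [Ring R] {S : Submonoid R}

/-- If r s = 0 and s' r = r' s^n, then r' s^n s^n = s' r s^n = 0, using n ≥ 1. For n with lann(s^n)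
= lann(s^(2n)) this gives s' r = 0. -/
lemma mem_leftDen_of_mem_leftOre (hG : IsLeftGoldie R) (hS : S ∈ leftOre R) : S ∈ leftDen R := by
  refine ⟨hS, fun r s hs hrs => ?_⟩
  obtain ⟨n, hn, hsq⟩ := exists_pow_lann_sq hG s
  obtain ⟨s', hs', r', e⟩ := hS.2 r (s ^ n) (S.pow_mem hs n)
  refine ⟨s', hs', ?_⟩
  obtain ⟨k, rfl⟩ := Nat.exists_eq_succ_of_ne_zero hn
  rw [e]
  refine hsq r' ?_
  rw [← e, pow_succ', mul_assoc s', ← mul_assoc r, hrs, zero_mul, mul_zero]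

lemma op_mem_leftOre (h : S ∈ rightOre R) : S.op ∈ leftOre Rᵐᵒᵖ := by
  refine ⟨fun h0 => h.1 (by simpa using h0), fun r s hs => ?_⟩
  obtain ⟨s', hs', r', e⟩ := h.2 r.unop s.unop hs
  exact ⟨.op s', hs', .op r', MulOpposite.unop_injective e⟩

lemma mem_rightDen_of_mem_rightOre (hG : IsLeftGoldie Rᵐᵒᵖ) (hS : S ∈ rightOre R) :
    S ∈ rightDen R := by
  refine ⟨hS, fun r s hs hrs => ?_⟩
  obtain ⟨t, ht, e⟩ := (mem_leftDen_of_mem_leftOre hG (op_mem_leftOre hS)).2 (.op r) (.op s) hs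
    (congrArg MulOpposite.op hrs)
  exact ⟨t.unop, ht, congrArg MulOpposite.unop e⟩

lemma ore_eq_den (hG : IsGoldie R) : ore R = den R :=
  Set.Subset.antisymm
    (fun _ hS => ⟨mem_leftDen_of_mem_leftOre hG.1 hS.1, mem_rightDen_of_mem_rightOre hG.2 hS.2⟩)
    fun _ hS => ⟨hS.1.1, hS.2.1⟩

/-- Some element of an Ore set is annihilated by all elements that are annihilated by an element of
the set. -/
lemma exists_mem_forall_mul_eq_zero (hG : IsLeftGoldie R) (hS : S ∈ rightOre R) :
    ∃ s₀ ∈ S, ∀ r, ∀ s ∈ S, r * s = 0 → r * s₀ = 0 := by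
  obtain ⟨s₀, hs₀, hmax⟩ := exists_lann_maximal hG (· ∈ S) ⟨1, S.one_mem⟩
  refine ⟨s₀, hs₀, fun r s hs hrs => ?_⟩
  -- The common multiple s s' = s₀ r' lies in S and its left annihilator contains those of s and of
  -- s₀; the latter is maximal.
  obtain ⟨s', hs', r', e⟩ := hS.2 s s₀ hs₀
  refine mem_lann.1 (hmax (s * s') (S.mul_mem hs hs') (fun x hx => mem_lann.2 ?_) (mem_lann.2 ?_))
  · rw [e, ← mul_assoc, mem_lann.1 hx, zero_mul]
  · rw [← mul_assoc, hrs, zero_mul]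

end Ore

/-! ### Maximal elements of a family with a cofinal antichain. -/

lemma maxElts_sep_eq_range {α : Type u} [PartialOrder α] {κ : Type*} {F : Set α} {C : κ → α} {a : α}
    (hCF : ∀ i, C i ∈ F) (haC : ∀ i, a ≤ C i) (hF : ∀ S ∈ F, a ≤ S → ∃ i, S ≤ C i)
    (hC : ∀ i j, C i ≤ C j → i = j) : {S ∈ maxElts F | a ≤ S} = Set.range C := by
  ext S
  constructor
  · rintro ⟨hS, haS⟩
    obtain ⟨i, hi⟩ := hF S hS.1 haS
    exact ⟨i, le_antisymm (hS.2 (hCF i) hi) hi⟩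
  · rintro ⟨i, rfl⟩
    refine ⟨⟨hCF i, fun T hT hiT => ?_⟩, haC i⟩
    obtain ⟨j, hj⟩ := hF T hT ((haC i).trans hiT)
    rwa [hC i j (hiT.trans hj)]

lemma maxElts_eq_range {α : Type u} [PartialOrder α] {κ : Type*} {F : Set α} {C : κ → α}
    (hCF : ∀ i, C i ∈ F) (hF : ∀ S ∈ F, ∃ i, S ≤ C i) (hC : ∀ i j, C i ≤ C j → i = j) :
    maxElts F = Set.range C := by
  ext S
  constructor
  · intro hS
    obtain ⟨i, hi⟩ := hF S hS.1
    exact ⟨i, le_antisymm (hS.2 (hCF i) hi) hi⟩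
  · rintro ⟨i, rfl⟩
    refine ⟨hCF i, fun T hT hiT => ?_⟩
    obtain ⟨j, hj⟩ := hF T hT
    rwa [hC i j (hiT.trans hj)]

/-! ### Rings with a semisimple classical quotient ring -/

/-- `f` identifies the finite product of the rings `A i` with the two-sided classical quotient ring
of `R`. -/
structure IsQuotientProduct {R : Type u} [Ring R] {κ : Type w} {A : κ → Type v} [∀ i, Ring (A i)]
    (f : R →+* ∀ i, A i) : Prop where
  injective : Function.Injective f
  isUnit : ∀ c ∈ nonZeroDivisors R, IsUnit (f c)
  left : ∀ q, ∃ c ∈ nonZeroDivisors R, ∃ r, f c * q = f r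
  right : ∀ q, ∃ c ∈ nonZeroDivisors R, ∃ r, q * f c = f r
  -- Targets in the universe of R suffice: the property is applied to the rings `Localize S`.
  lift : ∀ {B : Type u} [Ring B] (h : R →+* B), (∀ c ∈ nonZeroDivisors R, IsUnit (h c)) →
    ∃ g : (∀ i, A i) →+* B, ∀ r, g (f r) = h r

section Quotient

variable {R : Type u} [Ring R] {κ : Type w} {A : κ → Type v} [∀ i, Ring (A i)]

/-- The component of `f` at `i`. -/
def comp (f : R →+* ∀ i, A i) (i : κ) : R →+* A i := (Pi.evalRingHom A i).comp f

lemma comp_apply (f : R →+* ∀ i, A i) (i : κ) (r : R) : comp f i r = f r i := rfl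

/-- The elements which become units in the component `A i`. -/
def unitsAt (f : R →+* ∀ i, A i) (i : κ) : Submonoid R := (IsUnit.submonoid (A i)).comap (comp f i)

lemma mem_unitsAt {f : R →+* ∀ i, A i} {i : κ} {r : R} : r ∈ unitsAt f i ↔ IsUnit (f r i) := Iff.rfl

/-- The kernel of the component of `f` at `i`. -/
def kerAt (f : R →+* ∀ i, A i) (i : κ) : TwoSidedIdeal R := TwoSidedIdeal.ker (comp f i)

lemma mem_kerAt {f : R →+* ∀ i, A i} {i : κ} {r : R} : r ∈ kerAt f i ↔ f r i = 0 :=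
  TwoSidedIdeal.mem_ker (comp f i)

lemma ass_le_kerAt {f : R →+* ∀ i, A i} {S : Submonoid R} {i : κ} (h : S ≤ unitsAt f i) :
    ass S ≤ kerAt f i := by
  obtain ⟨l, hl⟩ := Localize.exists_lift (f := comp f i) fun s hs => mem_unitsAt.1 (h hs)
  intro r hr
  rw [mem_kerAt, ← comp_apply, ← hl, (TwoSidedIdeal.mem_ker _).1 hr, map_zero]

/-! ### Separating the components by elements of R. -/

namespace IsQuotientProduct

variable {f : R →+* ∀ i, A i} (hf : IsQuotientProduct f)
include hf

lemma le_unitsAt (i : κ) : nonZeroDivisors R ≤ unitsAt f i :=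
  fun c hc => (hf.isUnit c hc).map (Pi.evalRingHom A i)

lemma eq_zero_of_forall {r : R} (h : ∀ i, f r i = 0) : r = 0 :=
  hf.injective ((funext h).trans (map_zero f).symm)

variable [DecidableEq κ]

lemma left_single (i : κ) (q : A i) : ∃ c ∈ nonZeroDivisors R, ∃ r,
    f c i * q = f r i ∧ ∀ j, j ≠ i → f r j = 0 := by
  obtain ⟨c, hc, r, e⟩ := hf.left (Pi.single i q)
  refine ⟨c, hc, r, ?_, fun j hj => ?_⟩
  · rw [← e, Pi.mul_apply, Pi.single_eq_same]
  · rw [← e, Pi.mul_apply, Pi.single_eq_of_ne hj, mul_zero]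

lemma right_single (i : κ) (q : A i) : ∃ c ∈ nonZeroDivisors R, ∃ r,
    q * f c i = f r i ∧ ∀ j, j ≠ i → f r j = 0 := by
  obtain ⟨c, hc, r, e⟩ := hf.right (Pi.single i q)
  refine ⟨c, hc, r, ?_, fun j hj => ?_⟩
  · rw [← e, Pi.mul_apply, Pi.single_eq_same]
  · rw [← e, Pi.mul_apply, Pi.single_eq_of_ne hj, zero_mul]

lemma exists_mem_unitsAt (i : κ) : ∃ t ∈ unitsAt f i, ∀ j, j ≠ i → f t j = 0 := by
  obtain ⟨c, hc, t, e, ht⟩ := hf.left_single i 1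
  rw [mul_one] at e
  exact ⟨t, mem_unitsAt.2 (e ▸ hf.le_unitsAt i hc), ht⟩

lemma eq_of_unitsAt_le [∀ i, Nontrivial (A i)] {i j : κ} (h : unitsAt f i ≤ unitsAt f j) :
    i = j := by
  obtain ⟨t, ht, h0⟩ := hf.exists_mem_unitsAt i
  by_contra hij
  exact not_isUnit_zero (h0 j (Ne.symm hij) ▸ mem_unitsAt.1 (h ht))

lemma eq_of_kerAt_le [∀ i, Nontrivial (A i)] {i j : κ} (h : kerAt f i ≤ kerAt f j) : i = j := by
  obtain ⟨t, ht, h0⟩ := hf.exists_mem_unitsAt j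
  by_contra hij
  have := h (mem_kerAt.2 (h0 i hij))
  exact not_isUnit_zero (mem_kerAt.1 this ▸ mem_unitsAt.1 ht)

/-- Write r s⁻¹ = c⁻¹ b in `A i` with c regular in R. Then c r - b s vanishes at i, so it is
annihilated by the separating element t, and t c r = t b s. -/
lemma unitsAt_mem_leftDen [∀ i, Nontrivial (A i)] (i : κ) : unitsAt f i ∈ leftDen R := by
  obtain ⟨t, ht, ht0⟩ := hf.exists_mem_unitsAt i
  have kill : ∀ x, f x i = 0 → t * x = 0 := fun x hx => hf.eq_zero_of_forall fun j => by
    rw [map_mul, Pi.mul_apply]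
    by_cases h : j = i
    · subst h; rw [hx, mul_zero]
    · rw [ht0 j h, zero_mul]
  refine ⟨⟨fun h => not_isUnit_zero (M₀ := A i) ?_, fun r s hs => ?_⟩, fun r s hs e => ?_⟩
  · simpa only [mem_unitsAt, map_zero, Pi.zero_apply] using h
  · obtain ⟨u, hu⟩ := mem_unitsAt.1 hs
    obtain ⟨c, hc, b, e, -⟩ := hf.left_single i (f r i * (u⁻¹ : (A i)ˣ))
    refine ⟨t * c, mul_mem ht (hf.le_unitsAt i hc), t * b, ?_⟩
    have h0 := kill (c * r - b * s) (by
      rw [map_sub, map_mul, map_mul, Pi.sub_apply, Pi.mul_apply, Pi.mul_apply, ← e, ← hu, mul_assoc,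
        mul_assoc, Units.inv_mul, mul_one, sub_self])
    rwa [mul_sub, sub_eq_zero, ← mul_assoc, ← mul_assoc] at h0
  · refine ⟨t, ht, kill r ((mem_unitsAt.1 hs).mul_left_eq_zero.1 ?_)⟩
    rw [← Pi.mul_apply, ← map_mul, e, map_zero, Pi.zero_apply]

lemma unitsAt_mem_rightDen [∀ i, Nontrivial (A i)] (i : κ) : unitsAt f i ∈ rightDen R := by
  obtain ⟨t, ht, ht0⟩ := hf.exists_mem_unitsAt i
  have kill : ∀ x, f x i = 0 → x * t = 0 := fun x hx => hf.eq_zero_of_forall fun j => by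
    rw [map_mul, Pi.mul_apply]
    by_cases h : j = i
    · subst h; rw [hx, zero_mul]
    · rw [ht0 j h, mul_zero]
  refine ⟨⟨(hf.unitsAt_mem_leftDen i).1.1, fun r s hs => ?_⟩, fun r s hs e => ?_⟩
  · obtain ⟨u, hu⟩ := mem_unitsAt.1 hs
    obtain ⟨c, hc, b, e, -⟩ := hf.right_single i ((u⁻¹ : (A i)ˣ) * f r i)
    refine ⟨c * t, mul_mem (hf.le_unitsAt i hc) ht, b * t, ?_⟩
    have h0 := kill (r * c - s * b) (by
      rw [map_sub, map_mul, map_mul, Pi.sub_apply, Pi.mul_apply, Pi.mul_apply, ← e, ← hu, mul_assoc,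
        Units.mul_inv_cancel_left, sub_self])
    rwa [sub_mul, sub_eq_zero, mul_assoc, mul_assoc] at h0
  · refine ⟨t, ht, kill r ((mem_unitsAt.1 hs).mul_right_eq_zero.1 ?_)⟩
    rw [← Pi.mul_apply, ← map_mul, e, map_zero, Pi.zero_apply]

lemma unitsAt_mem_den [∀ i, Nontrivial (A i)] (i : κ) : unitsAt f i ∈ den R :=
  ⟨hf.unitsAt_mem_leftDen i, hf.unitsAt_mem_rightDen i⟩

/-! #### The minimal primes -/

/-- R/P_i embeds in `A i`, whose elements are left and right fractions over it. Regular elements of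
R/P_i therefore stay regular in `A i`, where they are units. -/
lemma regularMod_kerAt [∀ i, IsArtinianRing (A i)] (i : κ) :
    regularMod (kerAt f i) = unitsAt f i := by
  have hmk : ∀ r : R, (kerAt f i).ringCon.mk' r = 0 ↔ f r i = 0 := fun r => by
    rw [← TwoSidedIdeal.mem_ker, TwoSidedIdeal.ker_ringCon_mk', mem_kerAt]
  ext c
  rw [mem_unitsAt]
  change (kerAt f i).ringCon.mk' c ∈ nonZeroDivisors _ ↔ _
  constructor
  · intro hc
    rw [mem_nonZeroDivisors_iff] at hc
    rw [IsArtinianRing.isUnit_iff_mem_nonZeroDivisors, mem_nonZeroDivisors_iff]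
    constructor
    · intro q hq
      obtain ⟨d, hd, r, e, -⟩ := hf.right_single i q
      refine (mem_unitsAt.1 (hf.le_unitsAt i hd)).mul_left_eq_zero.1 (e.trans ((hmk r).1 ?_))
      refine hc.1 _ ?_
      rw [← map_mul, hmk, map_mul, Pi.mul_apply, ← e, ← mul_assoc, hq, zero_mul]
    · intro q hq
      obtain ⟨d, hd, r, e, -⟩ := hf.left_single i q
      refine (mem_unitsAt.1 (hf.le_unitsAt i hd)).mul_right_eq_zero.1 (e.trans ((hmk r).1 ?_))
      refine hc.2 _ ?_
      rw [← map_mul, hmk, map_mul, Pi.mul_apply, ← e, mul_assoc, hq, mul_zero]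
  · intro hc
    have hsurj : Function.Surjective (kerAt f i).ringCon.mk' := RingCon.mk'_surjective _
    refine mem_nonZeroDivisors_iff.2 ⟨fun x hx => ?_, fun x hx => ?_⟩
    · obtain ⟨r, rfl⟩ := hsurj x
      rw [← map_mul, hmk, map_mul, Pi.mul_apply] at hx
      exact (hmk r).2 (hc.mul_right_eq_zero.1 hx)
    · obtain ⟨r, rfl⟩ := hsurj x
      rw [← map_mul, hmk, map_mul, Pi.mul_apply] at hx
      exact (hmk r).2 (hc.mul_left_eq_zero.1 hx)

lemma isPrimeIdeal_kerAt [∀ i, IsSimpleRing (A i)] [∀ i, IsArtinianRing (A i)] (i : κ) :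
    IsPrimeIdeal (kerAt f i) := by
  refine ⟨fun h => ?_, fun a b hab => ?_⟩
  · have : (1 : R) ∈ kerAt f i := h ▸ TwoSidedIdeal.mem_top R
    rw [mem_kerAt, map_one, Pi.one_apply] at this
    exact one_ne_zero this
  by_contra! hne
  rw [mem_kerAt, mem_kerAt] at hne
  -- N is the left annihilator of f(R) f(b) in `A i`. Once it is known to be two-sided, simplicity
  -- and the nonzero element f(a) of N give 1 ∈ N, hence f(b) = 0 at i.
  let N : Ideal (A i) :=
    { carrier := {x | ∀ r, x * f r i * f b i = 0}
      add_mem' := fun hx hy r => by rw [add_mul, add_mul, hx r, hy r, add_zero]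
      zero_mem' := fun r => by rw [zero_mul, zero_mul]
      smul_mem' := fun q x hx r => by
        rw [smul_eq_mul, mul_assoc, mul_assoc, ← mul_assoc x, hx r, mul_zero] }
  have hNr : ∀ x ∈ N, ∀ r, x * f r i ∈ N := fun x hx r r' => by
    rw [mul_assoc x, ← Pi.mul_apply, ← map_mul]; exact hx _
  have hNq : ∀ x ∈ N, ∀ q, x * q ∈ N := by
    intro x hx q
    obtain ⟨c, hc, r, e, -⟩ := hf.right_single i q
    have hcu := mem_unitsAt.1 (hf.le_unitsAt i hc)
    -- Right multiplication by f(c) is injective on the Artinian module N, hence onto, so N is also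
    -- stable under f(c)⁻¹ and thus under all right fractions.
    have hsurj := IsArtinian.surjective_of_injective_endomorphism
      ((LinearMap.toSpanSingleton (A i) (A i) (f c i)).restrict (p := N) (q := N)
        fun y hy => hNr y hy c) fun y z hyz => Subtype.ext (hcu.mul_right_cancel
          (congrArg Subtype.val hyz))
    obtain ⟨y, hy⟩ := hsurj ⟨x * f r i, hNr x hx r⟩
    have hy' : (y : A i) * f c i = x * f r i := congrArg Subtype.val hy
    rw [← e, ← mul_assoc] at hy'
    exact hcu.mul_right_cancel hy' ▸ y.2
  let I : TwoSidedIdeal (A i) := TwoSidedIdeal.mk' N N.zero_mem N.add_mem N.neg_mem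
    (fun hy => N.mul_mem_left _ hy) (fun {x y} hx => hNq x hx y)
  have hI : ∀ x, x ∈ I ↔ x ∈ N := TwoSidedIdeal.mem_mk' _ _ _ _ _ _
  have h1 : (1 : A i) ∈ N := (hI _).1 <|
    IsSimpleRing.one_mem_of_ne_zero_mem I hne.1 ((hI _).2 fun r => by
      simpa [mem_kerAt, map_mul] using hab r)
  exact hne.2 (by simpa using h1 1)

/-- Otherwise elements of the P_i outside P combine, by primeness, into a product outside P that
lies in every P_i and so is zero. -/
lemma exists_kerAt_le [Fintype κ] {P : TwoSidedIdeal R} (hP : IsPrimeIdeal P) :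
    ∃ i, kerAt f i ≤ P := by
  by_contra! h
  have h' : ∀ i, ∃ a ∈ kerAt f i, a ∉ P := fun i => SetLike.not_le_iff_exists.1 (h i)
  choose a ha haP using h'
  have key : ∀ s : Finset κ, ∃ x ∉ P, ∀ i ∈ s, x ∈ kerAt f i := by
    intro s
    induction s using Finset.induction_on with
    | empty => exact ⟨1, fun h1 => hP.1 (P.one_mem_iff.1 h1), by simp⟩
    | insert j s _ ih =>
      obtain ⟨x, hx, hxs⟩ := ih
      obtain ⟨r, hr⟩ : ∃ r, x * r * a j ∉ P := by
        by_contra! hr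
        exact (hP.2 _ _ hr).elim hx (haP j)
      refine ⟨_, hr, fun i hi => ?_⟩
      rcases Finset.mem_insert.1 hi with rfl | hi
      · exact TwoSidedIdeal.mul_mem_left _ _ _ (ha i)
      · rw [mul_assoc]; exact TwoSidedIdeal.mul_mem_right _ _ _ (hxs i hi)
  obtain ⟨x, hx, hxs⟩ := key Finset.univ
  exact hx (hf.eq_zero_of_forall (fun i => mem_kerAt.1 (hxs i (Finset.mem_univ i))) ▸ P.zero_mem)

lemma minPrimes_eq_range [Fintype κ] [∀ i, IsSimpleRing (A i)] [∀ i, IsArtinianRing (A i)] :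
    minPrimes R = Set.range (kerAt f) := by
  ext P
  constructor
  · intro hP
    obtain ⟨i, hi⟩ := hf.exists_kerAt_le hP.1
    exact ⟨i, le_antisymm hi (hP.2 (hf.isPrimeIdeal_kerAt i) hi)⟩
  · rintro ⟨i, rfl⟩
    refine ⟨hf.isPrimeIdeal_kerAt i, fun P hP hPi => ?_⟩
    obtain ⟨j, hj⟩ := hf.exists_kerAt_le hP
    rwa [hf.eq_of_kerAt_le (hj.trans hPi)] at hj

/-! #### Maximality of the sets `unitsAt f i` -/

/-- One s₀ in S is killed on the left by everything that some element of S kills. Pick i with s₀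
nonzero at i. -/
lemma exists_le_unitsAt_of_mem_ore [∀ i, IsSimpleRing (A i)] [∀ i, IsArtinianRing (A i)]
    (hG : IsGoldie R) {S : Submonoid R} (hS : S ∈ ore R) : ∃ i, S ≤ unitsAt f i := by
  obtain ⟨s₀, hs₀, hs₀r⟩ := exists_mem_forall_mul_eq_zero hG.1 hS.2
  obtain ⟨i, hi⟩ : ∃ i, f s₀ i ≠ 0 := by
    by_contra! h
    exact hS.1.1 (hf.eq_zero_of_forall h ▸ hs₀)
  have hker : ∀ r, ∀ s ∈ S, r * s = 0 → f r i = 0 := by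
    intro r s hs hrs
    obtain ⟨t, ht, htr⟩ := (ore_eq_den hG ▸ hS : S ∈ den R).1.2 r s hs hrs
    -- From t r = 0 comes t r x = 0, so r x u = 0 for some u in S, so r x s₀ = 0, for every x;
    -- primeness of P_i then applies.
    refine mem_kerAt.1 (((hf.isPrimeIdeal_kerAt i).2 r s₀ fun x => ?_).resolve_right
      fun h => hi (mem_kerAt.1 h))
    obtain ⟨u, hu, hxu⟩ := (ore_eq_den hG ▸ hS : S ∈ den R).2.2 (r * x) t ht
      (by rw [← mul_assoc, htr, zero_mul])
    rw [hs₀r _ u hu hxu]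
    exact TwoSidedIdeal.zero_mem _
  refine ⟨i, fun s hs => ?_⟩
  rw [mem_unitsAt, IsArtinianRing.isUnit_iff_isRightRegular, isRightRegular_iff_left_eq_zero_of_mul]
  intro q hq
  -- A q in `A i` with q s = 0 becomes, after clearing its denominator, an r in R with r s = 0.
  obtain ⟨c, hc, r, e, hr⟩ := hf.left_single i q
  refine (mem_unitsAt.1 (hf.le_unitsAt i hc)).mul_right_eq_zero.1 (e.trans (hker r s hs ?_))
  refine hf.eq_zero_of_forall fun j => ?_
  rw [map_mul, Pi.mul_apply]
  by_cases h : j = i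
  · subst h; rw [← e, mul_assoc, hq, mul_zero]
  · rw [hr j h, zero_mul]

lemma exists_le_unitsAt_of_nontrivial [Fintype κ] [∀ i, IsSimpleRing (A i)]
    [∀ i, IsArtinianRing (A i)] {S : Submonoid R} [Nontrivial (Localize S)]
    (hS : nonZeroDivisors R ≤ S) : ∃ i, S ≤ unitsAt f i := by
  obtain ⟨g, hg⟩ := hf.lift (Localize.of S) fun c hc => Localize.isUnit_of (hS hc)
  obtain ⟨i, hi⟩ : ∃ i, g (Pi.single i 1) ≠ 0 := by
    by_contra! h
    refine one_ne_zero (α := Localize S) ?_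
    rw [← map_one g, ← Finset.univ_sum_single (1 : ∀ i, A i), map_sum]
    exact Finset.sum_eq_zero fun i _ => h i
  -- The kernel of g on the factor `A i` omits 1, so it is zero by simplicity. An equation q s = 0
  -- in `A i` maps into R⟨S⁻¹⟩, where s is invertible, and so forces q = 0.
  let I : TwoSidedIdeal (A i) := TwoSidedIdeal.mk' {q | g (Pi.single i q) = 0}
    (by simp) (fun {x y} hx hy => by
      rw [Set.mem_ofPred_eq] at *; rw [Pi.single_add, map_add, hx, hy, add_zero])
    (fun {x} hx => by rw [Set.mem_ofPred_eq] at *; rw [Pi.single_neg, map_neg, hx, neg_zero])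
    (fun {x y} hy => by rw [Set.mem_ofPred_eq] at *; rw [Pi.single_mul, map_mul, hy, mul_zero])
    (fun {x y} hx => by rw [Set.mem_ofPred_eq] at *; rw [Pi.single_mul, map_mul, hx, zero_mul])
  have hI : ∀ q, q ∈ I ↔ g (Pi.single i q) = 0 := TwoSidedIdeal.mem_mk' _ _ _ _ _ _
  refine ⟨i, fun s hs => ?_⟩
  rw [mem_unitsAt, IsArtinianRing.isUnit_iff_isRightRegular, isRightRegular_iff_left_eq_zero_of_mul]
  intro q hq
  by_contra hq0
  refine hi ((hI 1).1 (IsSimpleRing.one_mem_of_ne_zero_mem I hq0 ((hI q).2 ?_)))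
  refine (Localize.isUnit_of hs).mul_left_eq_zero.1 ?_
  rw [← hg, ← map_mul, ← Pi.single_mul_left, hq, Pi.single_zero, map_zero]

/-! #### The localizations at the sets `unitsAt f i` -/

/-- The separating element t becomes invertible in the localization and kills the other components.
Hence the map g from the product depends only on the coordinate i, and this yields the inverse map.
-/
lemma exists_localize_equiv (i : κ) : ∃ e : Localize (unitsAt f i) ≃+* A i,
    ∀ r, e (Localize.of _ r) = f r i := by
  obtain ⟨l, hl⟩ := Localize.exists_lift (S := unitsAt f i) (f := comp f i) fun s hs => hs
  obtain ⟨g, hg⟩ := hf.lift (Localize.of (unitsAt f i))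
    fun c hc => Localize.isUnit_of (hf.le_unitsAt i hc)
  obtain ⟨t, ht, ht0⟩ := hf.exists_mem_unitsAt i
  have hgi : ∀ x y, x i = y i → g x = g y := by
    intro x y hxy
    refine (Localize.isUnit_of ht).mul_right_cancel ?_
    rw [← hg, ← map_mul, ← map_mul]
    congr 1
    funext j
    rw [Pi.mul_apply, Pi.mul_apply]
    by_cases h : j = i
    · subst h; rw [hxy]
    · rw [ht0 j h, mul_zero, mul_zero]
  let h : A i →+* Localize (unitsAt f i) :=
    { toFun := fun q => g (Pi.single i q)
      map_one' := (hgi _ 1 (by simp)).trans (map_one g)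
      map_mul' := fun x y => by rw [Pi.single_mul, map_mul]
      map_zero' := by rw [Pi.single_zero, map_zero]
      map_add' := fun x y => by rw [Pi.single_add, map_add] }
  have hh : ∀ r, h (f r i) = Localize.of _ r := fun r => (hgi _ _ (by simp)).trans (hg r)
  refine ⟨RingEquiv.ofRingHom l h ?_ (Localize.hom_ext fun r => ?_), hl⟩
  · refine hom_ext_of_left_fractions (S := nonZeroDivisors R) (ι := comp f i)
      (fun s hs => hf.le_unitsAt i hs) (fun q => ?_) fun r => ?_
    · obtain ⟨c, hc, r, e, -⟩ := hf.left_single i q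
      exact ⟨c, hc, r, e⟩
    · change l (h (f r i)) = f r i
      rw [hh, hl, comp_apply]
  · change h (l (Localize.of _ r)) = _
    rw [hl, comp_apply, hh, RingHom.id_apply]

lemma ass_unitsAt (i : κ) : ass (unitsAt f i) = kerAt f i := by
  obtain ⟨e, he⟩ := hf.exists_localize_equiv i
  refine TwoSidedIdeal.ext fun r => ?_
  rw [mem_kerAt, ← he, e.map_eq_zero_iff]
  exact TwoSidedIdeal.mem_ker _

lemma unitsAt_mem_leftLocalizable [∀ i, Nontrivial (A i)] (i : κ) :
    unitsAt f i ∈ leftLocalizable R := by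
  obtain ⟨e, he⟩ := hf.exists_localize_equiv i
  refine ⟨(hf.unitsAt_mem_leftDen i).1.1, e.toEquiv.nontrivial, fun q => ?_⟩
  obtain ⟨c, hc, r, h, -⟩ := hf.left_single i (e q)
  rw [← he, ← he, ← map_mul] at h
  refine ⟨⟨c, hf.le_unitsAt i hc⟩, r, ?_⟩
  rw [← e.injective h, ← mul_assoc]
  exact ((congrArg (· * q) (Localize.inv_mul_of (S := unitsAt f i)
    ⟨c, hf.le_unitsAt i hc⟩)).trans (one_mul q)).symm

lemma unitsAt_mem_rightLocalizable [∀ i, Nontrivial (A i)] (i : κ) :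
    unitsAt f i ∈ rightLocalizable R := by
  obtain ⟨e, he⟩ := hf.exists_localize_equiv i
  refine ⟨(hf.unitsAt_mem_leftDen i).1.1, e.toEquiv.nontrivial, fun q => ?_⟩
  obtain ⟨c, hc, r, h, -⟩ := hf.right_single i (e q)
  rw [← he, ← he, ← map_mul] at h
  refine ⟨⟨c, hf.le_unitsAt i hc⟩, r, ?_⟩
  rw [← e.injective h, mul_assoc]
  exact ((congrArg (q * ·) (Localize.of_mul_inv (S := unitsAt f i)
    ⟨c, hf.le_unitsAt i hc⟩)).trans (mul_one q)).symm

lemma maxElts_ore [∀ i, IsSimpleRing (A i)] [∀ i, IsArtinianRing (A i)] (hG : IsGoldie R) :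
    maxElts (ore R) = Set.range (unitsAt f) :=
  maxElts_eq_range (fun i => ore_eq_den hG ▸ hf.unitsAt_mem_den i)
    (fun _ => hf.exists_le_unitsAt_of_mem_ore hG) fun _ _ => hf.eq_of_unitsAt_le

lemma maxElts_sep_eq_range_unitsAt [Fintype κ] [∀ i, IsSimpleRing (A i)]
    [∀ i, IsArtinianRing (A i)] {F : Set (Submonoid R)} (hF : ∀ i, unitsAt f i ∈ F)
    (hnt : ∀ S ∈ F, Nontrivial (Localize S)) :
    {S ∈ maxElts F | nonZeroDivisors R ≤ S} = Set.range (unitsAt f) :=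
  LocSets.maxElts_sep_eq_range hF hf.le_unitsAt
    (fun S hS => have := hnt S hS; hf.exists_le_unitsAt_of_nontrivial)
    fun _ _ => hf.eq_of_unitsAt_le

lemma maxElts_ass [∀ i, IsSimpleRing (A i)] [∀ i, IsArtinianRing (A i)] (hG : IsGoldie R) :
    maxElts (ass '' ore R) = Set.range (kerAt f) := by
  refine maxElts_eq_range (fun i => ⟨_, ore_eq_den hG ▸ hf.unitsAt_mem_den i, hf.ass_unitsAt i⟩)
    ?_ fun _ _ => hf.eq_of_kerAt_le
  rintro _ ⟨S, hS, rfl⟩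
  obtain ⟨i, hi⟩ := hf.exists_le_unitsAt_of_mem_ore hG hS
  exact ⟨i, ass_le_kerAt hi⟩

/-- The quotient ring is the product of the localizations at the maximal Ore sets. -/
lemma exists_pi_equiv [∀ i, IsSimpleRing (A i)] [∀ i, IsArtinianRing (A i)] (hG : IsGoldie R) :
    ∃ e : (∀ i, A i) ≃+* ((S : maxElts (ore R)) → Localize (S : Submonoid R)),
      ∀ r, e (f r) = fun S : maxElts (ore R) => Localize.of (S : Submonoid R) r := by
  choose e he using fun i => hf.exists_localize_equiv i
  have hr := hf.maxElts_ore hG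
  let m : κ ≃ maxElts (ore R) := Equiv.ofBijective (fun i => ⟨unitsAt f i, hr ▸ ⟨i, rfl⟩⟩)
    ⟨fun i j hij => hf.eq_of_unitsAt_le (congrArg Subtype.val hij).le, fun S => by
      obtain ⟨i, hi⟩ : (S : Submonoid R) ∈ Set.range (unitsAt f) := hr ▸ S.2
      exact ⟨i, Subtype.ext hi⟩⟩
  let e₁ : (∀ i, A i) ≃+* ∀ i, Localize (m i : Submonoid R) :=
    RingEquiv.piCongrRight fun i => (e i).symm
  refine ⟨e₁.trans (RingEquiv.piCongrLeft
    (fun S : maxElts (ore R) => Localize (S : Submonoid R)) m), fun r => funext fun S => ?_⟩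
  obtain ⟨i, rfl⟩ := m.surjective S
  refine (Equiv.piCongrLeft_apply_apply (fun S : maxElts (ore R) => Localize (S : Submonoid R))
    m _ i).trans ?_
  change (e i).symm (f r i) = Localize.of (unitsAt f i) r
  rw [← he, RingEquiv.symm_apply_apply]

end IsQuotientProduct

end Quotient

/-! ### Wedderburn–Artin decomposition of the quotient ring and left-right symmetry. -/

lemma IsSimpleArtinian.of_ringEquiv {A B : Type u} [Ring A] [Ring B] [IsSimpleRing A]
    [IsArtinianRing A] (e : A ≃+* B) : IsSimpleArtinian B := by
  have h1 : IsSimpleRing B := IsSimpleRing.of_ringEquiv e inferInstance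
  have h2 : IsArtinianRing B := e.isArtinianRing
  -- Semisimplicity is left-right symmetric, so it supplies the Artinian condition on the opposite
  -- side.
  have h3 : IsSemisimpleRing B := inferInstance
  exact ⟨h1, h2, inferInstance⟩

theorem exists_isQuotientProduct {R : Type u} [Ring R] [Nontrivial R] (hsp : IsSemiprime R)
    (hG : IsGoldie R) (hl : nonZeroDivisors R ∈ leftDen R) (hr : nonZeroDivisors R ∈ rightDen R) :
    ∃ (n : ℕ) (A : Fin n → Type u) (_ : ∀ i, Ring (A i)) (f : R →+* ∀ i, A i)
      (e : LeftFrac (nonZeroDivisors R) hl ≃+* ∀ i, A i), (∀ i, IsSimpleRing (A i)) ∧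
      (∀ i, IsArtinianRing (A i)) ∧ (∀ r, e (LeftFrac.of hl r) = f r) ∧ IsQuotientProduct f := by
  have hinj := LeftFrac.of_injective hl le_rfl
  have hss := isSemisimpleRing_of_left_fractions hsp hG (LeftFrac.of hl) hinj
    (fun c hc => LeftFrac.isUnit_of hl hc) (LeftFrac.exists_frac hl)
  obtain ⟨n, D, d, _, _, ⟨e⟩⟩ := IsSemisimpleRing.exists_ringEquiv_pi_matrix_divisionRing
    (LeftFrac (nonZeroDivisors R) hl)
  refine ⟨n, fun i => Matrix (Fin (d i)) (Fin (d i)) (D i), fun i => inferInstance,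
    e.toRingHom.comp (LeftFrac.of hl), e, fun i => inferInstance, fun i => inferInstance,
    fun r => rfl, ⟨e.injective.comp hinj, fun c hc => (LeftFrac.isUnit_of hl hc).map e,
      fun q => ?_, fun q => ?_, fun h hh => ?_⟩⟩
  · obtain ⟨c, hc, r, h⟩ := LeftFrac.exists_frac hl (e.symm q)
    refine ⟨c, hc, r, ?_⟩
    simpa using congrArg e h
  · obtain ⟨k, hk⟩ := exists_leftFrac_equiv_rightFrac hl hr
    obtain ⟨c, hc, r, h⟩ := RightFrac.exists_frac hr (k (e.symm q))
    refine ⟨c, hc, r, ?_⟩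
    rw [← hk, ← hk, ← map_mul] at h
    simpa using congrArg e (k.injective h)
  · obtain ⟨g, hg⟩ := LeftFrac.exists_lift hl hh
    exact ⟨g.comp e.symm.toRingHom, fun r => by simpa using hg r⟩

/-- Needed for R ≃ Rᵐᵒᵖᵐᵒᵖ, so that the opposite ring is again Goldie and the left-hand results
apply to it. -/
lemma IsLeftGoldie.of_ringEquiv {R : Type u} {R' : Type v} [Ring R] [Ring R'] (e : R ≃+* R')
    (h : IsLeftGoldie R) : IsLeftGoldie R' := by
  let o : Ideal R' ≃o Ideal R := Ideal.relIsoOfBijective e e.bijective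
  refine ⟨fun I hI => ?_, fun I hI => ?_⟩
  · obtain ⟨n, hn⟩ := h.1 (fun n => o (I n)) (hI.map_orderIso o)
    exact ⟨n, o.injective (hn.trans (map_bot o).symm)⟩
  · obtain ⟨n, hn⟩ := h.2 ⟨fun n => o (I n), fun _ _ hab => o.monotone (I.monotone hab)⟩ fun n => by
      obtain ⟨X, hX⟩ := hI n
      refine ⟨e ⁻¹' X, ?_⟩
      change Ideal.comap e (I n) = _
      rw [hX]
      ext r
      refine ⟨fun hr x hx => e.injective ?_, fun hr x hx => ?_⟩
      · rw [map_mul, map_zero]; exact hr _ hx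
      · have := congrArg e (hr (e.symm x) (by simpa using hx))
        simpa using this
    exact ⟨n, fun m hm => o.injective (hn m hm)⟩

theorem nonZeroDivisors_mem_rightDen {R : Type u} [Ring R] [Nontrivial R] (hsp : IsSemiprime R)
    (hG : IsGoldie R) : nonZeroDivisors R ∈ rightDen R := by
  have h := nonZeroDivisors_mem_leftDen hsp.op ⟨hG.2, hG.1.of_ringEquiv (RingEquiv.opOp R)⟩
  have hop : ∀ s : R, .op s ∈ nonZeroDivisors Rᵐᵒᵖ ↔ s ∈ nonZeroDivisors R := fun s => by
    simp only [mem_nonZeroDivisors_iff, MulOpposite.forall, ← MulOpposite.op_mul,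
      MulOpposite.op_eq_zero_iff, and_comm]
  refine ⟨⟨zero_notMem_nonZeroDivisors, fun r s hs => ?_⟩, fun r s hs h => ⟨1, one_mem _, ?_⟩⟩
  · obtain ⟨c, hc, x, e⟩ := h.1.2 (.op r) (.op s) ((hop s).2 hs)
    exact ⟨c.unop, (hop _).1 hc, x.unop, congrArg MulOpposite.unop e⟩
  · rw [(mem_nonZeroDivisors_iff.1 hs).1 r h, zero_mul]

end LocSets

end

theorem mainTheorem1 {R : Type*} [Ring R] [Nontrivial R]
    (hsp : LocSets.IsSemiprime R) (hG : LocSets.IsGoldie R) :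
    -- the five sets coincide with the set of all `C(p)`, `p` a minimal prime
    (LocSets.maxElts (LocSets.ore R) = LocSets.maxElts (LocSets.den R) ∧
      LocSets.maxElts (LocSets.den R) = LocSets.regularMod '' LocSets.minPrimes R ∧
      LocSets.regularMod '' LocSets.minPrimes R =
        {S ∈ LocSets.maxElts (LocSets.leftLocalizable R) | nonZeroDivisors R ≤ S} ∧
      LocSets.regularMod '' LocSets.minPrimes R =
        {S ∈ LocSets.maxElts (LocSets.rightLocalizable R) | nonZeroDivisors R ≤ S} ∧
      LocSets.regularMod '' LocSets.minPrimes R =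
        {S ∈ LocSets.maxElts (LocSets.localizable R) | nonZeroDivisors R ≤ S}) ∧
    -- the localizations at the maximal Ore sets are simple Artinian
    (∀ S ∈ LocSets.maxElts (LocSets.ore R), LocSets.IsSimpleArtinian (LocSets.Localize S)) ∧
    -- the left and right classical quotient rings exist, are `R`-isomorphic, and are
    -- `R`-isomorphic to the product of the localizations at the maximal Ore sets
    (∃ (hl : nonZeroDivisors R ∈ LocSets.leftDen R) (hr : nonZeroDivisors R ∈ LocSets.rightDen R),
      (∃ e : LocSets.LeftFrac (nonZeroDivisors R) hl ≃+*
          LocSets.RightFrac (nonZeroDivisors R) hr,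
        ∀ r : R, e (LocSets.LeftFrac.of hl r) = LocSets.RightFrac.of hr r) ∧
      (∃ e : LocSets.LeftFrac (nonZeroDivisors R) hl ≃+*
          ((S : LocSets.maxElts (LocSets.ore R)) → LocSets.Localize (S : Submonoid R)),
        ∀ r : R, e (LocSets.LeftFrac.of hl r) =
          fun S : LocSets.maxElts (LocSets.ore R) => LocSets.Localize.of (S : Submonoid R) r)) ∧
    -- the ideals `ass(S)`
    (LocSets.maxElts (LocSets.ass '' LocSets.ore R) =
        LocSets.ass '' LocSets.maxElts (LocSets.ore R) ∧
      LocSets.ass '' LocSets.maxElts (LocSets.ore R) = LocSets.minPrimes R ∧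
      IsAntichain (· ≤ ·) (LocSets.ass '' LocSets.maxElts (LocSets.ore R))) := by
  have hl := LocSets.nonZeroDivisors_mem_leftDen hsp hG
  have hr := LocSets.nonZeroDivisors_mem_rightDen hsp hG
  obtain ⟨n, A, _, f, e, _, _, he, hf⟩ := LocSets.exists_isQuotientProduct hsp hG hl hr
  have hore := hf.maxElts_ore hG
  have hC : LocSets.regularMod '' LocSets.minPrimes R = Set.range (LocSets.unitsAt f) := by
    rw [hf.minPrimes_eq_range, ← Set.range_comp]
    exact congrArg Set.range (funext hf.regularMod_kerAt)
  have hass : LocSets.ass '' LocSets.maxElts (LocSets.ore R) = Set.range (LocSets.kerAt f) := by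
    rw [hore, ← Set.range_comp]
    exact congrArg Set.range (funext hf.ass_unitsAt)
  refine ⟨⟨by rw [LocSets.ore_eq_den hG], by rw [← LocSets.ore_eq_den hG, hore, hC], ?_, ?_, ?_⟩,
    ?_, ⟨hl, hr, LocSets.exists_leftFrac_equiv_rightFrac hl hr, ?_⟩,
    (hf.maxElts_ass hG).trans hass.symm, hass.trans hf.minPrimes_eq_range.symm, ?_⟩
  · rw [hC, hf.maxElts_sep_eq_range_unitsAt hf.unitsAt_mem_leftLocalizable fun S hS => hS.2.1]
  · rw [hC, hf.maxElts_sep_eq_range_unitsAt hf.unitsAt_mem_rightLocalizable fun S hS => hS.2.1]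
  · rw [hC, hf.maxElts_sep_eq_range_unitsAt
      (F := LocSets.localizable R)
      (fun i => ⟨hf.unitsAt_mem_leftLocalizable i, hf.unitsAt_mem_rightLocalizable i⟩)
      fun S hS => hS.1.2.1]
  · rw [hore]
    rintro _ ⟨i, rfl⟩
    obtain ⟨e, -⟩ := hf.exists_localize_equiv i
    exact LocSets.IsSimpleArtinian.of_ringEquiv e.symm
  · obtain ⟨k, hk⟩ := hf.exists_pi_equiv hG
    exact ⟨e.trans k, fun r => by rw [RingEquiv.trans_apply, he, hk]⟩
  · rw [hass]
    rintro _ ⟨i, rfl⟩ _ ⟨j, rfl⟩ hij hle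
    exact hij (congrArg _ (hf.eq_of_kerAt_le hle))
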